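/- Let $n\ge 1$ and let $(M^n,g)$ be a smooth oriented and time-oriented Lorentzian manifold, $g$ having signature $(-,+,\dots,+)$, with a spin structure $(Q,f)$: a principal bundle $Q\to M$ with group $\mathrm{Spin}_0(1,n-1)$ (the double cover, via $\lambda$, of the group $SO_0(1,n-1)$ of Lorentz transformations preserving orientation and time orientation), together with a $\lambda$-equivariant bundle map $f$ to the bundle of oriented, time-oriented orthonormal frames. Let $e_1,\dots,e_n$ be the standard basis of Minkowski space $\mathbb R^{1,n-1}$, with $e_1$ timelike, let the Clifford algebra be normalised by $x\cdot x=-\langle x,x\rangle$, put $m=\lfloor n/2\rfloor$, and let the spinor module $\Delta_{1,n-1}=\mathbb C^{2^m}=(\mathbb C^2)^{\otimes m}$ be defined by $$e_{2j-1}\mapsto \tau_{2j-1}\,E\otimes\cdots\otimes E\otimes g_1\otimes T^{\otimes (j-1)},\qquad e_{2j}\mapsto \tau_{2j}\,E\otimes\cdots\otimes E\otimes g_2\otimes T^{\otimes (j-1)}\qquad(1\le j\le m),$$ and $e_n\mapsto \tau_n\, i\,T^{\otimes m}$ if $n$ is odd, where $\tau_1=i$, $\tau_k=1$ for $k\ge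 2$, and $$E=\begin{pmatrix}1&0\\0&1\end{pmatrix},\quad T=\begin{pmatrix}0&-i\\ i&0\end{pmatrix},\quad g_1=\begin{pmatrix}i&0\\0&-i\end{pmatrix},\quad g_2=\begin{pmatrix}0&i\\ i&0\end{pmatrix}.$$ Let $S=Q\times_{\mathrm{Spin}_0(1,n-1)}\Delta_{1,n-1}$ be the spinor bundle, with Clifford multiplication $X\cdot\varphi$ and with the indefinite Hermitian inner product $\langle\cdot,\cdot\rangle$ induced by $\langle v,w\rangle_\Delta=(e_1\cdot v,w)$, where $(\cdot,\cdot)$ is the standard Hermitian product of $\mathbb C^{2^m}$. The Dirac current of a smooth spinor field $\varphi\in\Gamma(S)$ is the vector field $V_\varphi$ defined by $g(V_\varphi,X)=-\langle X\cdot\varphi,\varphi\rangle$ for all tangent vectors $X$. If $\varphi$ is a smooth spinor field whose Dirac current is lightlike, i.e. $g(V_\varphi,V_\varphi)=0$ at every point of $M$ (zeros of $V_\varphi$ are allowed), then $V_\varphi\cdot\varphi=0$ and $\langle\varphi,\varphi\rangle=0$ on all of $M$. -/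

import Mathlib

open scoped Manifold ContDiff Matrix

noncomputable section

namespace LorentzSpin

/-! ## The Clifford algebra and the spinor module of Minkowski space -/

section Algebra

variable (n : ℕ) [NeZero n]

/-- The diagonal entries of the Minkowski inner product of signature `(-, +, …, +)` in the standard
basis `e 0, …, e (n-1)`; the timelike basis vector is `e 0`. -/
def minkowskiSign {n : ℕ} [NeZero n] (j : Fin n) : ℝ := if j = 0 then -1 else 1

/-- The quadratic form `x ↦ -⟨x, x⟩` on Minkowski space. Mathlib's Clifford algebra of this form
has the relation `x * x = -⟨x, x⟩`. -/
def cliffordForm : QuadraticForm ℝ (Fin n → ℝ) :=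
  QuadraticMap.weightedSumSquares ℝ (fun j : Fin n => -minkowskiSign j)

/-- The Clifford algebra of Minkowski space with the relation `x * x = -⟨x, x⟩`. -/
abbrev Cl : Type := CliffordAlgebra (cliffordForm n)

/-- The spin group: products of an even number of vectors with spinor norm one. This is the
group that doubly covers the group of Lorentz transformations preserving orientation and time
orientation. -/
abbrev Spin : Type := spinGroup (cliffordForm n)

/-- The topology of the spin group as a subspace of the finite dimensional real vector space
`Cl n`. -/
instance : TopologicalSpace (Spin n) :=
  (moduleTopology ℝ (Cl n)).induced Subtype.val

/-- The spinor module: `m = n / 2` tensor factors `ℂ²`, written in the product basis. -/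
abbrev SpinorModule : Type := (Fin (n / 2) → Fin 2) → ℂ

end Algebra

/-- The Kronecker product of the 2 × 2 matrices `A 0, …, A (m-1)`. -/
def kron {m : ℕ} (A : Fin m → Matrix (Fin 2) (Fin 2) ℂ) :
    Matrix (Fin m → Fin 2) (Fin m → Fin 2) ℂ :=
  Matrix.of fun i j => ∏ p, A p (i p) (j p)

/-- The matrix `T`. -/
def matT : Matrix (Fin 2) (Fin 2) ℂ := !![0, -Complex.I; Complex.I, 0]

/-- The matrix `g₁`. -/
def matG1 : Matrix (Fin 2) (Fin 2) ℂ := !![Complex.I, 0; 0, -Complex.I]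

/-- The matrix `g₂`. -/
def matG2 : Matrix (Fin 2) (Fin 2) ℂ := !![0, Complex.I; Complex.I, 0]

/-- The tensor factor in position `p` of the Clifford matrix with (zero based) number `j`. With
`k = j / 2` the product is `E ⊗ ⋯ ⊗ E ⊗ g ⊗ T ⊗ ⋯ ⊗ T`, with `k` factors `T`, where `g` is `g₁` for
even `j` and `g₂` for odd `j`. If `n` is odd and `j = n - 1`, all the factors are `T`. -/
def gammaFactor {m : ℕ} (j : ℕ) (p : Fin m) : Matrix (Fin 2) (Fin 2) ℂ :=
  if (p : ℕ) + j / 2 + 1 < m then 1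
  else if (p : ℕ) + j / 2 + 1 = m then (if j % 2 = 0 then matG1 else matG2)
  else matT

/-- The scalar `τ`: it is `i` for the timelike basis vector and `1` for the others. -/
def tau {n : ℕ} [NeZero n] (j : Fin n) : ℂ := if j = 0 then Complex.I else 1

/-- The Clifford matrix of the basis vector `e j`. The last one for odd `n` is
`i • T ⊗ ⋯ ⊗ T`. -/
def gamma {n : ℕ} [NeZero n] (j : Fin n) :
    Matrix (Fin (n / 2) → Fin 2) (Fin (n / 2) → Fin 2) ℂ :=
  tau j • (if (j : ℕ) = 2 * (n / 2) then Complex.I • kron (fun _ => matT)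
    else kron (gammaFactor j))

lemma kron_mul {m : ℕ} (A B : Fin m → Matrix (Fin 2) (Fin 2) ℂ) :
    kron A * kron B = kron (fun p => A p * B p) := by
  ext i j
  simp only [kron, Matrix.mul_apply, Matrix.of_apply]
  rw [Finset.prod_univ_sum, Fintype.piFinset_univ]
  simp [Finset.prod_mul_distrib]

lemma kron_one {m : ℕ} : kron (fun _ : Fin m => (1 : Matrix (Fin 2) (Fin 2) ℂ)) = 1 := by
  ext i j
  simp only [kron, Matrix.of_apply, Matrix.one_apply]
  rw [Finset.prod_ite_zero]
  simp [funext_iff]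

lemma kron_smul {m : ℕ} (c : Fin m → ℂ) (A : Fin m → Matrix (Fin 2) (Fin 2) ℂ) :
    kron (fun p => c p • A p) = (∏ p, c p) • kron A := by
  ext i j
  simp [kron, Finset.prod_mul_distrib]

lemma kron_conjTranspose {m : ℕ} (A : Fin m → Matrix (Fin 2) (Fin 2) ℂ) :
    (kron A)ᴴ = kron (fun p => (A p)ᴴ) := by
  ext i j
  simp [kron, Matrix.conjTranspose_apply]

lemma matT_sq : matT * matT = 1 := by
  ext i j; fin_cases i <;> fin_cases j <;> simp [matT]
lemma matG1_sq : matG1 * matG1 = -1 := by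
  ext i j; fin_cases i <;> fin_cases j <;> simp [matG1]
lemma matG2_sq : matG2 * matG2 = -1 := by
  ext i j; fin_cases i <;> fin_cases j <;> simp [matG2]
lemma matG1_T : matG1 * matT = -(matT * matG1) := by
  ext i j; fin_cases i <;> fin_cases j <;> simp [matG1, matT]
lemma matG2_T : matG2 * matT = -(matT * matG2) := by
  ext i j; fin_cases i <;> fin_cases j <;> simp [matG2, matT]
lemma matG1_G2 : matG1 * matG2 = -(matG2 * matG1) := by
  ext i j; fin_cases i <;> fin_cases j <;> simp [matG1, matG2]
lemma matT_conj : matTᴴ = matT := by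
  ext i j; fin_cases i <;> fin_cases j <;> simp [matT, Matrix.conjTranspose_apply]
lemma matG1_conj : matG1ᴴ = -matG1 := by
  ext i j; fin_cases i <;> fin_cases j <;> simp [matG1, Matrix.conjTranspose_apply]
lemma matG2_conj : matG2ᴴ = -matG2 := by
  ext i j; fin_cases i <;> fin_cases j <;> simp [matG2, Matrix.conjTranspose_apply]

lemma kron_gammaFactor_last {m : ℕ} :
    kron (gammaFactor (m := m) (2 * m)) = kron (fun _ => matT) := by
  congr 1
  funext p
  simp only [gammaFactor]
  rw [if_neg (by omega), if_neg (by omega)]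

lemma prod_sign {m : ℕ} (r : ℕ) (hr : r < m) :
    (∏ p : Fin m, if (p : ℕ) + r + 1 = m then (-1 : ℂ) else 1) = -1 := by
  rw [Finset.prod_eq_single (⟨m - 1 - r, by omega⟩ : Fin m)]
  · rw [if_pos]; show m - 1 - r + r + 1 = m; omega
  · intro b _ hb
    rw [if_neg]
    intro h
    exact hb (Fin.ext (by show (b : ℕ) = m - 1 - r; omega))
  · simp

lemma kron_gammaFactor_sq {m : ℕ} (j : ℕ) :
    kron (gammaFactor (m := m) j) * kron (gammaFactor j) = if j / 2 < m then -1 else 1 := by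
  have key : ∀ p : Fin m, gammaFactor j p * gammaFactor j p
      = (if (p : ℕ) + j / 2 + 1 = m then (-1 : ℂ) else 1) • (1 : Matrix (Fin 2) (Fin 2) ℂ) := by
    intro p
    simp only [gammaFactor]
    split_ifs <;> first | omega | simp [matT_sq, matG1_sq, matG2_sq]
  rw [kron_mul, funext key, kron_smul, kron_one]
  split_ifs with h
  · rw [prod_sign _ h]; simp
  · rw [Finset.prod_eq_one]
    · simp
    · intro p _; rw [if_neg]; have := p.2; omega

lemma kron_gammaFactor_anticomm {m : ℕ} {j k : ℕ} (hjk : j < k) (hk : k ≤ 2 * m) :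
    kron (gammaFactor (m := m) j) * kron (gammaFactor k)
      = -(kron (gammaFactor k) * kron (gammaFactor j)) := by
  have key : ∀ p : Fin m, gammaFactor j p * gammaFactor k p
      = (if (p : ℕ) + j / 2 + 1 = m then (-1 : ℂ) else 1) • (gammaFactor k p * gammaFactor j p) := by
    intro p
    simp only [gammaFactor]
    split_ifs <;> first | omega | simp [matG1_T, matG2_T, matG1_G2]
  rw [kron_mul, funext key, kron_smul, kron_mul, prod_sign _ (by omega)]
  simp

lemma kron_gammaFactor_conj {m : ℕ} (j : ℕ) :
    (kron (gammaFactor (m := m) j))ᴴ = (if j / 2 < m then -1 else 1 : ℂ) • kron (gammaFactor j) := by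
  have key : ∀ p : Fin m, (gammaFactor j p)ᴴ
      = (if (p : ℕ) + j / 2 + 1 = m then (-1 : ℂ) else 1) • gammaFactor j p := by
    intro p
    simp only [gammaFactor]
    split_ifs <;> first | omega | simp [matT_conj, matG1_conj, matG2_conj]
  rw [kron_conjTranspose, funext key, kron_smul]
  split_ifs with h
  · rw [prod_sign _ h]
  · rw [Finset.prod_eq_one]
    intro p _; rw [if_neg]; have := p.2; omega

lemma gamma_eq {n : ℕ} [NeZero n] (j : Fin n) :
    gamma j = (tau j * if (j : ℕ) / 2 < n / 2 then 1 else Complex.I) •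
      kron (gammaFactor (m := n / 2) j) := by
  have := j.2
  unfold gamma
  split_ifs with h1 h2 h2
  · omega
  · rw [h1, kron_gammaFactor_last, smul_smul]
  · simp
  · omega

lemma gamma_sq {n : ℕ} [NeZero n] (j : Fin n) :
    gamma j * gamma j = (-(minkowskiSign j : ℂ)) • 1 := by
  rw [gamma_eq, Matrix.smul_mul, Matrix.mul_smul, kron_gammaFactor_sq, smul_smul]
  unfold tau minkowskiSign
  split_ifs <;> simp

lemma gamma_anticomm_aux {n : ℕ} [NeZero n] {j k : Fin n} (h : j < k) :
    gamma j * gamma k = -(gamma k * gamma j) := by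
  rw [gamma_eq, gamma_eq]
  simp only [Matrix.smul_mul, Matrix.mul_smul, smul_smul]
  rw [kron_gammaFactor_anticomm h (by have := k.2; omega), smul_neg, mul_comm]

lemma gamma_anticomm {n : ℕ} [NeZero n] {j k : Fin n} (h : j ≠ k) :
    gamma j * gamma k = -(gamma k * gamma j) := by
  rcases lt_or_gt_of_ne h with h | h
  · exact gamma_anticomm_aux h
  · rw [gamma_anticomm_aux h, neg_neg]

lemma gamma_conj {n : ℕ} [NeZero n] (j : Fin n) :
    (gamma j)ᴴ = (-(minkowskiSign j : ℂ)) • gamma j := by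
  rw [gamma_eq, Matrix.conjTranspose_smul, kron_gammaFactor_conj, smul_smul, smul_smul]
  congr 1
  unfold tau minkowskiSign
  split_ifs <;> simp

section Rep

variable (n : ℕ) [NeZero n]

/-- Clifford multiplication by a vector `x = ∑ j, x j • e j` on the spinor module. -/
def gammaLin : (Fin n → ℝ) →ₗ[ℝ] Matrix (Fin (n / 2) → Fin 2) (Fin (n / 2) → Fin 2) ℂ :=
  Fintype.linearCombination ℝ (fun j : Fin n => gamma j)

lemma gammaLin_apply (x : Fin n → ℝ) : gammaLin n x = ∑ j, x j • gamma j := rfl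

lemma gammaLin_sq (x : Fin n → ℝ) :
    gammaLin n x * gammaLin n x = algebraMap ℝ _ (cliffordForm n x) := by
  have h : ∀ j k : Fin n, gamma j * gamma k + gamma k * gamma j
      = if j = k then (-2 * minkowskiSign j) • (1 : Matrix (Fin (n / 2) → Fin 2) _ ℂ) else 0 := by
    intro j k
    split_ifs with hjk
    · subst hjk
      rw [gamma_sq, ← add_smul]
      ext a b
      simp only [Matrix.smul_apply, smul_eq_mul, Complex.real_smul]
      push_cast
      ring
    · rw [gamma_anticomm hjk]; simp
  have e1 : gammaLin n x * gammaLin n x = ∑ j, ∑ k, (x j * x k) • (gamma j * gamma k) := by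
    simp only [gammaLin_apply, Finset.sum_mul, Finset.mul_sum, smul_mul_smul_comm]
    exact Finset.sum_comm
  have e2 : gammaLin n x * gammaLin n x = ∑ j, ∑ k, (x j * x k) • (gamma k * gamma j) := by
    rw [e1, Finset.sum_comm]
    refine Finset.sum_congr rfl fun j _ => Finset.sum_congr rfl fun k _ => ?_
    rw [mul_comm]
  have e3 : (2 : ℝ) • (gammaLin n x * gammaLin n x)
      = (2 : ℝ) • algebraMap ℝ _ (cliffordForm n x) := by
    rw [two_smul]
    nth_rewrite 1 [e1]
    rw [e2, ← Finset.sum_add_distrib]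
    simp only [← Finset.sum_add_distrib, ← smul_add, h]
    simp only [smul_ite, smul_zero, Finset.sum_ite_eq, Finset.mem_univ, if_true, smul_smul,
      ← Finset.sum_smul, Algebra.algebraMap_eq_smul_one]
    congr 1
    simp only [cliffordForm, QuadraticMap.weightedSumSquares_apply, Finset.mul_sum, smul_eq_mul]
    exact Finset.sum_congr rfl fun j _ => by ring
  exact (smul_right_injective _ (two_ne_zero (α := ℝ))) e3

/-- The spinor representation of the Clifford algebra on the spinor module. -/
def spinRep : Cl n →ₐ[ℝ] Matrix (Fin (n / 2) → Fin 2) (Fin (n / 2) → Fin 2) ℂ :=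
  CliffordAlgebra.lift (cliffordForm n) ⟨gammaLin n, gammaLin_sq n⟩

lemma spinRep_ι (x : Fin n → ℝ) :
    spinRep n (CliffordAlgebra.ι _ x) = gammaLin n x :=
  CliffordAlgebra.lift_ι_apply _ _ _ 

/-- The inner product `⟨v, w⟩ = (e 0 · v, w)` on the spinor module, where `(·, ·)` is the standard
Hermitian product of `ℂ^(2^m)`. -/
def moduleInner (v w : SpinorModule n) : ℂ := (gamma (0 : Fin n) *ᵥ v) ⬝ᵥ star w

lemma gamma_zero_conj : (gamma (0 : Fin n))ᴴ = gamma 0 := by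
  rw [gamma_conj]; simp [minkowskiSign]

lemma conj_gamma_mul (j : Fin n) : (gamma j)ᴴ * gamma 0 = gamma 0 * gamma j := by
  rw [gamma_conj]
  by_cases h : j = 0
  · subst h; simp [minkowskiSign]
  · rw [Matrix.smul_mul, gamma_anticomm h]; simp [minkowskiSign, h]

lemma conj_gammaLin_mul (x : Fin n → ℝ) :
    (gammaLin n x)ᴴ * gamma 0 = gamma 0 * gammaLin n x := by
  simp only [gammaLin_apply, Matrix.conjTranspose_sum, Finset.sum_mul, Finset.mul_sum]
  refine Finset.sum_congr rfl fun j _ => ?_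
  rw [Matrix.conjTranspose_smul, Matrix.smul_mul, conj_gamma_mul, Matrix.mul_smul]
  simp

/-- The adjoint of a Clifford element with respect to `moduleInner` is its reverse. -/
lemma conj_spinRep_mul (a : Cl n) :
    (spinRep n a)ᴴ * gamma 0 = gamma 0 * spinRep n (CliffordAlgebra.reverse a) := by
  induction a using CliffordAlgebra.induction with
  | algebraMap r =>
    rw [CliffordAlgebra.reverse.commutes, AlgHom.commutes, Algebra.algebraMap_eq_smul_one,
      Matrix.conjTranspose_smul]
    simp
  | ι x => rw [CliffordAlgebra.reverse_ι, spinRep_ι, conj_gammaLin_mul]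
  | mul a b ha hb =>
    rw [CliffordAlgebra.reverse.map_mul, map_mul, map_mul, Matrix.conjTranspose_mul, mul_assoc, ha,
      ← mul_assoc, hb, mul_assoc]
  | add a b ha hb =>
    rw [map_add, map_add, map_add, Matrix.conjTranspose_add, add_mul, mul_add, ha, hb]

lemma moduleInner_mulVec (A B : Matrix (Fin (n / 2) → Fin 2) (Fin (n / 2) → Fin 2) ℂ)
    (h : Aᴴ * gamma 0 = gamma 0 * B) (v w : SpinorModule n) :
    moduleInner n v (A *ᵥ w) = moduleInner n (B *ᵥ v) w := by
  simp only [moduleInner]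
  rw [Matrix.star_mulVec, Matrix.mulVec_mulVec, ← h, ← Matrix.mulVec_mulVec, dotProduct_comm,
    ← Matrix.dotProduct_mulVec, dotProduct_comm]

lemma moduleInner_conj (v w : SpinorModule n) :
    star (moduleInner n v w) = moduleInner n w v := by
  simp only [moduleInner]
  rw [← Matrix.star_dotProduct_star, star_star, Matrix.star_mulVec, gamma_zero_conj,
    dotProduct_comm, ← Matrix.dotProduct_mulVec, dotProduct_comm]

lemma spin_reverse_mul (a : Spin n) : CliffordAlgebra.reverse (a : Cl n) * (a : Cl n) = 1 := by
  have h := spinGroup.star_mul_self_of_mem a.2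
  rwa [CliffordAlgebra.star_def, spinGroup.involute_eq a.2] at h

lemma moduleInner_spin (a : Spin n) (v w : SpinorModule n) :
    moduleInner n (spinRep n a *ᵥ v) (spinRep n a *ᵥ w) = moduleInner n v w := by
  rw [moduleInner_mulVec n _ _ (conj_spinRep_mul n a), Matrix.mulVec_mulVec, ← map_mul,
    spin_reverse_mul]
  simp

lemma ι_injective : Function.Injective (CliffordAlgebra.ι (cliffordForm n)) := by
  intro x y h
  have h2 := congrArg (CliffordAlgebra.equivExterior (cliffordForm n)) h
  simp only [CliffordAlgebra.equivExterior, CliffordAlgebra.changeFormEquiv_apply,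
    CliffordAlgebra.changeForm_ι] at h2
  exact (ExteriorAlgebra.ι_inj ℝ x y).1 h2

lemma conj_ι_mem (a : Spin n) (x : Fin n → ℝ) :
    (a : Cl n) * CliffordAlgebra.ι _ x * star (a : Cl n)
      ∈ LinearMap.range (CliffordAlgebra.ι (cliffordForm n)) := by
  have h := spinGroup.conjAct_smul_ι_mem_range_ι (Q := cliffordForm n)
    (x := spinGroup.toUnits a) a.2 x
  exact h

/-- The twofold covering of the Lorentz group by the spin group, as a linear action on Minkowski
space: `vectorRep n a x` is the vector `a * x * a⁻¹` (the inverse of `a` is `star a`). -/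
def vectorRep (a : Spin n) : (Fin n → ℝ) →ₗ[ℝ] (Fin n → ℝ) :=
  (LinearEquiv.ofInjective _ (ι_injective n)).symm.toLinearMap ∘ₗ
    LinearMap.codRestrict (LinearMap.range (CliffordAlgebra.ι (cliffordForm n)))
      (LinearMap.mulLeftRight ℝ ((a : Cl n), star (a : Cl n)) ∘ₗ CliffordAlgebra.ι _)
      (conj_ι_mem n a)

lemma ι_vectorRep (a : Spin n) (x : Fin n → ℝ) :
    CliffordAlgebra.ι (cliffordForm n) (vectorRep n a x)
      = (a : Cl n) * CliffordAlgebra.ι _ x * star (a : Cl n) := by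
  have h := LinearEquiv.apply_symm_apply (LinearEquiv.ofInjective _ (ι_injective n))
    ⟨_, conj_ι_mem n a x⟩
  exact congrArg Subtype.val h

lemma spinRep_inv_mul (a : Spin n) :
    spinRep n ((a⁻¹ : Spin n) : Cl n) * spinRep n (a : Cl n) = 1 := by
  rw [← map_mul, ← Submonoid.coe_mul, inv_mul_cancel]; simp

lemma spinRep_mul_inv (a : Spin n) :
    spinRep n (a : Cl n) * spinRep n ((a⁻¹ : Spin n) : Cl n) = 1 := by
  rw [← map_mul, ← Submonoid.coe_mul, mul_inv_cancel]; simp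

lemma gammaLin_vectorRep (a : Spin n) (x : Fin n → ℝ) :
    gammaLin n (vectorRep n a x)
      = spinRep n a * gammaLin n x * spinRep n ((a⁻¹ : Spin n) : Cl n) := by
  rw [← spinRep_ι, ι_vectorRep, map_mul, map_mul, spinRep_ι]
  rfl

end Rep

/-! ## Lorentzian manifolds, orientations, frames -/

section Geometry

variable (n : ℕ) [NeZero n] (M : Type*) [TopologicalSpace M]
  [ChartedSpace (EuclideanSpace ℝ (Fin n)) M] [IsManifold (𝓡 n) ∞ M]

/-- A smooth Lorentzian metric, of signature `(-, +, …, +)`: every tangent space has a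
pseudo-orthonormal basis with one timelike vector. -/
structure LorentzianMetric where
  inner (x : M) : TangentSpace (𝓡 n) x →L[ℝ] TangentSpace (𝓡 n) x →L[ℝ] ℝ
  symm (x : M) (v w : TangentSpace (𝓡 n) x) : inner x v w = inner x w v
  signature (x : M) : ∃ b : Module.Basis (Fin n) ℝ (TangentSpace (𝓡 n) x),
    ∀ i j, inner x (b i) (b j) = if i = j then minkowskiSign i else 0
  contMDiff : ContMDiff (𝓡 n)
    ((𝓡 n).prod 𝓘(ℝ, EuclideanSpace ℝ (Fin n) →L[ℝ] EuclideanSpace ℝ (Fin n) →L[ℝ] ℝ)) ∞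
    (fun x ↦ Bundle.TotalSpace.mk'
      (EuclideanSpace ℝ (Fin n) →L[ℝ] EuclideanSpace ℝ (Fin n) →L[ℝ] ℝ)
      (E := fun x : M ↦ TangentSpace (𝓡 n) x →L[ℝ] TangentSpace (𝓡 n) x →L[ℝ] ℝ) x (inner x))

/-- An orientation of a manifold: orientations of all tangent spaces which are, locally, those of
continuous frames. -/
structure ManifoldOrientation where
  at_ (x : M) : Orientation ℝ (TangentSpace (𝓡 n) x) (Fin n)
  continuous (x₀ : M) : ∃ U : Set M, IsOpen U ∧ x₀ ∈ U ∧
    ∃ b : ∀ x : M, Module.Basis (Fin n) ℝ (TangentSpace (𝓡 n) x),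
      (∀ i, ContinuousOn (fun x ↦ (⟨x, b x i⟩ : TangentBundle (𝓡 n) M)) U) ∧
        ∀ x ∈ U, (b x).orientation = at_ x

variable {n M}

/-- A time orientation, given by a continuous timelike vector field: the future is the half of the
light cone which contains the field. -/
structure TimeOrientation (g : LorentzianMetric n M) where
  field (x : M) : TangentSpace (𝓡 n) x
  timelike (x : M) : g.inner x (field x) (field x) < 0
  continuous : Continuous (fun x ↦ (⟨x, field x⟩ : TangentBundle (𝓡 n) M))

/-- The oriented and time-oriented orthonormal frames at a point (the fibre of the bundle of
frames with structure group the connected Lorentz group). -/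
structure LorentzFrame (g : LorentzianMetric n M) (o : ManifoldOrientation n M)
    (t : TimeOrientation g) (x : M) where
  basis : Module.Basis (Fin n) ℝ (TangentSpace (𝓡 n) x)
  orthonormal (i j : Fin n) : g.inner x (basis i) (basis j) = if i = j then minkowskiSign i else 0
  oriented : basis.orientation = o.at_ x
  future : g.inner x (basis 0) (t.field x) < 0

/-- A spin structure: a principal bundle `Q` of the spin group over `M` (with right action `act`),
together with a continuous map `frame` over `M` to the bundle of oriented and time-oriented
orthonormal frames which is equivariant with respect to the covering `vectorRep` of the Lorentz
group by the spin group. A frame `s` is viewed here as the isomorphism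
`x ↦ ∑ j, x j • s j` from Minkowski space to the tangent space, on which the Lorentz group acts by
composition from the right. -/
structure SpinStructure (g : LorentzianMetric n M) (o : ManifoldOrientation n M)
    (t : TimeOrientation g) where
  Q : M → Type*
  [topology : TopologicalSpace (Bundle.TotalSpace (Spin n) Q)]
  act {x : M} : Q x → Spin n → Q x
  act_one {x : M} (q : Q x) : act q 1 = q
  act_mul {x : M} (q : Q x) (a b : Spin n) : act q (a * b) = act (act q a) b
  locallyTrivial (x : M) :
    ∃ e : Bundle.Trivialization (Spin n) (Bundle.TotalSpace.proj : Bundle.TotalSpace (Spin n) Q → M),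
      x ∈ e.baseSet ∧ ∀ y ∈ e.baseSet, ∀ (q : Q y) (a : Spin n),
        (e ⟨y, act q a⟩).2 = (e ⟨y, q⟩).2 * a
  frame {x : M} : Q x → LorentzFrame g o t x
  frame_continuous (i : Fin n) : Continuous
    (fun p : Bundle.TotalSpace (Spin n) Q ↦ (⟨p.proj, (frame p.snd).basis i⟩ : TangentBundle (𝓡 n) M))
  frame_act {x : M} (q : Q x) (a : Spin n) (i : Fin n) :
    (frame (act q a)).basis i = ∑ j, vectorRep n a (Pi.single i 1) j • (frame q).basis j

attribute [instance] SpinStructure.topology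

end Geometry

/-! ## The spinor bundle -/

section Bundle

variable {n : ℕ} [NeZero n] {M : Type*} [TopologicalSpace M]
  [ChartedSpace (EuclideanSpace ℝ (Fin n)) M] [IsManifold (𝓡 n) ∞ M]
  {g : LorentzianMetric n M} {o : ManifoldOrientation n M} {t : TimeOrientation g}
  (P : SpinStructure g o t)

/-- The fibre at `x` of the spinor bundle associated with the spin structure by the spinor
representation. An element `[q, v]` of the associated bundle is represented by the equivariant map
`ψ : Q x → SpinorModule n` with `ψ (q · a) = a⁻¹ · v` for all `a`. -/
def SpinorFiber (x : M) : Submodule ℂ (P.Q x → SpinorModule n) where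
  carrier := {ψ | ∀ (q : P.Q x) (a : Spin n),
    ψ (P.act q a) = spinRep n ((a⁻¹ : Spin n) : Cl n) *ᵥ ψ q}
  add_mem' {ψ χ} h h' q a := by simp [h q a, h' q a, Matrix.mulVec_add]
  zero_mem' q a := by simp
  smul_mem' c ψ h q a := by simp [h q a, Matrix.mulVec_smul]

lemma nonempty_fiber (x : M) : Nonempty (P.Q x) := by
  obtain ⟨e, hx, -⟩ := P.locallyTrivial x
  have h := e.proj_symm_apply' hx (x := (1 : Spin n))
  generalize (e.toOpenPartialHomeomorph.symm (x, 1)) = p at h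
  exact ⟨h ▸ p.snd⟩

lemma act_transitive {x : M} (q q' : P.Q x) : ∃ a : Spin n, q' = P.act q a := by
  obtain ⟨e, hx, he⟩ := P.locallyTrivial x
  refine ⟨(e ⟨x, q⟩).2⁻¹ * (e ⟨x, q'⟩).2, ?_⟩
  have h2 := he x hx q ((e ⟨x, q⟩).2⁻¹ * (e ⟨x, q'⟩).2)
  rw [mul_inv_cancel_left] at h2
  have hs : ∀ r : P.Q x, (⟨x, r⟩ : Bundle.TotalSpace (Spin n) P.Q) ∈ e.source := fun r => by
    rw [e.mem_source]; exact hx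
  have h3 : (⟨x, q'⟩ : Bundle.TotalSpace (Spin n) P.Q) = 
      ⟨x, P.act q ((e ⟨x, q⟩).2⁻¹ * (e ⟨x, q'⟩).2)⟩ := by
    refine e.injOn (hs _) (hs _) (Prod.ext ?_ h2.symm)
    exact (e.coe_fst (hs q')).trans (e.coe_fst (hs (P.act q _))).symm
  simpa using h3

/-- The components of a tangent vector with respect to the frame defined by `q`. -/
def components {x : M} (q : P.Q x) (X : TangentSpace (𝓡 n) x) : Fin n → ℝ :=
  (P.frame q).basis.equivFun X

lemma components_act {x : M} (q : P.Q x) (a : Spin n) (X : TangentSpace (𝓡 n) x) :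
    components P q X = vectorRep n a (components P (P.act q a) X) := by
  unfold components
  set y := (P.frame (P.act q a)).basis.equivFun X with hy
  have hX : X = ∑ i, y i • (P.frame (P.act q a)).basis i :=
    ((P.frame (P.act q a)).basis.sum_equivFun X).symm
  have h1 : vectorRep n a y = ∑ i, y i • vectorRep n a (Pi.single i 1) := by
    conv_lhs => rw [pi_eq_sum_univ' y]
    rw [map_sum]
    refine Finset.sum_congr rfl fun i _ => ?_
    rw [map_smul]
  rw [← LinearEquiv.eq_symm_apply, Module.Basis.equivFun_symm_apply, h1]
  nth_rewrite 1 [hX]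
  simp only [P.frame_act, Finset.smul_sum, Finset.sum_apply, Pi.smul_apply, Finset.sum_smul,
    smul_smul, smul_eq_mul]
  rw [Finset.sum_comm]

/-- Clifford multiplication `X · ψ` of a spinor by a tangent vector. -/
def cliffordMul {x : M} (X : TangentSpace (𝓡 n) x) (ψ : SpinorFiber P x) : SpinorFiber P x :=
  ⟨fun q => gammaLin n (components P q X) *ᵥ ψ.1 q, fun q a => by
    change gammaLin n (components P (P.act q a) X) *ᵥ ψ.1 (P.act q a)
      = spinRep n ((a⁻¹ : Spin n) : Cl n) *ᵥ (gammaLin n (components P q X) *ᵥ ψ.1 q)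
    rw [components_act P q a, gammaLin_vectorRep, ψ.2 q a]
    simp only [Matrix.mulVec_mulVec, ← mul_assoc]
    rw [spinRep_inv_mul, one_mul]⟩

/-- The inner product `⟨ψ, χ⟩` on the spinor bundle, induced by the one on the spinor module
(it does not depend on the choice of the element of `Q x`, see `spinorInner_eq`). -/
def spinorInner {x : M} (ψ χ : SpinorFiber P x) : ℂ :=
  moduleInner n (ψ.1 (nonempty_fiber P x).some) (χ.1 (nonempty_fiber P x).some)

lemma spinorInner_eq {x : M} (ψ χ : SpinorFiber P x) (q : P.Q x) :
    spinorInner P ψ χ = moduleInner n (ψ.1 q) (χ.1 q) := by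
  obtain ⟨a, ha⟩ := act_transitive P q (nonempty_fiber P x).some
  rw [spinorInner, ha, ψ.2, χ.2, moduleInner_spin]

lemma cliffordMul_apply {x : M} (X : TangentSpace (𝓡 n) x) (ψ : SpinorFiber P x) (q : P.Q x) :
    (cliffordMul P X ψ).1 q = gammaLin n (components P q X) *ᵥ ψ.1 q := rfl

lemma spinorInner_cliffordMul {x : M} (X : TangentSpace (𝓡 n) x) (ψ χ : SpinorFiber P x) :
    spinorInner P (cliffordMul P X ψ) χ = spinorInner P ψ (cliffordMul P X χ) :=
  (moduleInner_mulVec n _ _ (conj_gammaLin_mul n _) _ _).symm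

lemma spinorInner_conj {x : M} (ψ χ : SpinorFiber P x) :
    star (spinorInner P ψ χ) = spinorInner P χ ψ :=
  moduleInner_conj n _ _

/-- The metric at a point as a bilinear form. -/
def LorentzianMetric.bilin (g : LorentzianMetric n M) (x : M) :
    LinearMap.BilinForm ℝ (TangentSpace (𝓡 n) x) :=
  LinearMap.mk₂ ℝ (fun v w => g.inner x v w) (by simp) (by simp) (by simp) (by simp)

lemma LorentzianMetric.bilin_nondegenerate (g : LorentzianMetric n M) (x : M) :
    (g.bilin x).Nondegenerate := by
  have key : ∀ v : TangentSpace (𝓡 n) x, (∀ w, g.inner x v w = 0) → v = 0 := by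
    obtain ⟨b, hb⟩ := g.signature x
    intro v hv
    rw [← b.sum_repr v]
    refine Finset.sum_eq_zero fun j _ => ?_
    have h := hv (b j)
    rw [← b.sum_repr v] at h
    simp only [map_sum, map_smul, sum_apply, smul_apply, hb, smul_eq_mul, mul_ite, mul_zero, Finset.sum_ite_eq', Finset.mem_univ, if_true,
      mul_eq_zero] at h
    rcases h with h | h
    · rw [h, zero_smul]
    · unfold minkowskiSign at h; split_ifs at h <;> norm_num at h
  refine ⟨key, fun v hv => key v fun w => ?_⟩
  rw [g.symm]
  exact hv w

/-- The linear form `X ↦ -⟨X · ψ, ψ⟩` on a tangent space. Its values are real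
(see `diracForm_eq`). -/
def diracForm {x : M} (ψ : SpinorFiber P x) : Module.Dual ℝ (TangentSpace (𝓡 n) x) where
  toFun X := -(spinorInner P (cliffordMul P X ψ) ψ).re
  map_add' X Y := by
    simp only [spinorInner, cliffordMul_apply, components, map_add, Matrix.add_mulVec, moduleInner,
      Matrix.mulVec_add, add_dotProduct, Complex.add_re]
    ring
  map_smul' c X := by
    simp only [spinorInner, cliffordMul_apply, components, map_smul, Matrix.smul_mulVec,
      moduleInner, Matrix.mulVec_smul, smul_dotProduct, Complex.real_smul, Complex.re_ofReal_mul,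
      RingHom.id_apply, smul_eq_mul]
    ring

lemma diracForm_eq {x : M} (ψ : SpinorFiber P x) (X : TangentSpace (𝓡 n) x) :
    (diracForm P ψ X : ℂ) = -spinorInner P (cliffordMul P X ψ) ψ := by
  have h : star (spinorInner P (cliffordMul P X ψ) ψ) = spinorInner P (cliffordMul P X ψ) ψ := by
    rw [spinorInner_conj, spinorInner_cliffordMul]
  rw [← Complex.conj_eq_iff_re.1 h]
  simp [diracForm]

/-- The Dirac current of a spinor `ψ` at `x`: the tangent vector `V` with
`g(V, X) = -⟨X · ψ, ψ⟩` for all `X`. -/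
def diracCurrent {x : M} (ψ : SpinorFiber P x) : TangentSpace (𝓡 n) x :=
  haveI : FiniteDimensional ℝ (TangentSpace (𝓡 n) x) :=
    inferInstanceAs (FiniteDimensional ℝ (EuclideanSpace ℝ (Fin n)))
  ((g.bilin x).toDual (g.bilin_nondegenerate x)).symm (diracForm P ψ)

lemma inner_diracCurrent {x : M} (ψ : SpinorFiber P x) (X : TangentSpace (𝓡 n) x) :
    (g.inner x (diracCurrent P ψ) X : ℂ) = -spinorInner P (cliffordMul P X ψ) ψ := by
  have : FiniteDimensional ℝ (TangentSpace (𝓡 n) x) :=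
    inferInstanceAs (FiniteDimensional ℝ (EuclideanSpace ℝ (Fin n)))
  rw [← diracForm_eq]
  exact congrArg _ (LinearMap.BilinForm.apply_toDual_symm_apply
    (hB := g.bilin_nondegenerate x) (diracForm P ψ) X)

/-- A smooth spinor field, i.e. a smooth section of the spinor bundle. The smooth structure of the
bundle `Q` is the one pulled back from the frame bundle by the covering `frame`: a continuous local
section `s` of `Q` is smooth if and only if the vector fields of the frame `frame ∘ s` are smooth.
A spinor field is smooth if and only if its representation by a function with values in the
spinor module is smooth with respect to every smooth local section `s` of `Q`. -/
structure SpinorField where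
  toFun (x : M) : SpinorFiber P x
  smooth (U : Set M) (s : ∀ x : M, P.Q x) : IsOpen U →
    ContinuousOn (fun x ↦ (⟨x, s x⟩ : Bundle.TotalSpace (Spin n) P.Q)) U →
    (∀ i, ContMDiffOn (𝓡 n) (𝓡 n).tangent ∞
      (fun x ↦ (⟨x, (P.frame (s x)).basis i⟩ : TangentBundle (𝓡 n) M)) U) →
    ContMDiffOn (𝓡 n) 𝓘(ℝ, SpinorModule n) ∞ (fun x ↦ (toFun x).1 (s x)) U

end Bundle

end LorentzSpin

end

open LorentzSpin

namespace LorentzSpin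

/-! ### Null vectors acting on the spinor module. -/

section Module

variable (n : ℕ) [NeZero n]

/-! The argument is pointwise and rests on comparing the indefinite product with the standard
Hermitian one. Write `γ₀` for `gamma 0`, `γ(x)` for `gammaLin n x` and `v` for the value of the
spinor in a frame. Since `γ(x)ᴴ = γ₀ γ(x) γ₀` and `γ₀ γ(x) + γ(x) γ₀ = 2 x⁰`, a null `x`, for which
`γ(x)² = 0`, satisfies `γ(x)ᴴ γ(x) = 2 x⁰ γ₀ γ(x)`. Hence `|x · v|² = 2 x⁰ ⟨x · v, v⟩`
(`gammaLin_mulVec_dotProduct_star_self`). For `x = V` the pairing on the right is `-g(V, V) = 0`, so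
`V · φ = 0`.

Given `V · φ = 0`, the anticommutator and the symmetry of Clifford multiplication give `2 V⁰ ⟨φ, φ⟩
= 0` (`moduleInner_self_eq_zero_of_gammaLin_mulVec_eq_zero`). Moreover `V⁰ = |φ|²`
(`components_diracCurrent_zero`), so either `V⁰ ≠ 0` and `⟨φ, φ⟩ = 0`, or `φ` itself vanishes at the
point. -/

lemma gamma_zero_sq : gamma (0 : Fin n) * gamma 0 = 1 := by
  rw [gamma_sq]; simp [minkowskiSign]

/-- The spacelike terms cancel by anticommutation. The timelike one survives with a plus sign
because `gamma 0` squares to `1`. -/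
lemma gammaLin_anticomm_gamma_zero (x : Fin n → ℝ) :
    gamma 0 * gammaLin n x + gammaLin n x * gamma 0 = (2 * x 0) • 1 := by
  simp only [gammaLin_apply, Finset.mul_sum, Finset.sum_mul, ← Finset.sum_add_distrib]
  rw [Finset.sum_eq_single 0]
  · rw [Matrix.mul_smul, Matrix.smul_mul, gamma_zero_sq, ← add_smul, two_mul]
  · intro j _ hj
    rw [Matrix.mul_smul, Matrix.smul_mul, gamma_anticomm hj]
    simp
  · simp

/-- Clifford multiplication by a null vector has the positive definite norm square
`2 x⁰ ⟨x · v, v⟩`. -/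
lemma gammaLin_mulVec_dotProduct_star_self (x : Fin n → ℝ) (hx : cliffordForm n x = 0)
    (v : SpinorModule n) :
    (gammaLin n x *ᵥ v) ⬝ᵥ star (gammaLin n x *ᵥ v)
      = (2 * x 0) • moduleInner n (gammaLin n x *ᵥ v) v := by
  have hsq : gammaLin n x * gammaLin n x = 0 := by rw [gammaLin_sq, hx, map_zero]
  have hconj : (gammaLin n x)ᴴ * gammaLin n x = (2 * x 0) • (gamma 0 * gammaLin n x) := by
    -- `gammaLin n x` is self-adjoint for `moduleInner`, so its Hermitian adjoint is its conjugate
    -- by the involution `gamma 0`.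
    have h : (gammaLin n x)ᴴ = gamma 0 * gammaLin n x * gamma 0 := by
      rw [← conj_gammaLin_mul, mul_assoc, gamma_zero_sq, mul_one]
    have hanti : gamma 0 * gammaLin n x = (2 * x 0) • 1 - gammaLin n x * gamma 0 :=
      eq_sub_of_add_eq (gammaLin_anticomm_gamma_zero n x)
    rw [h, mul_assoc]
    -- Only the right factor of `(γ₀ γ(x)) (γ₀ γ(x))` is expanded: the scalar part is the claim, and
    -- the other part contains `γ(x)² = 0`.
    nth_rewrite 2 [hanti]
    rw [mul_sub, mul_assoc (gamma 0) _ (_ * _), ← mul_assoc (gammaLin n x) (gammaLin n x), hsq]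
    simp
  rw [moduleInner, Matrix.star_mulVec, dotProduct_comm, ← Matrix.dotProduct_mulVec,
    Matrix.mulVec_mulVec, hconj, Matrix.smul_mulVec, dotProduct_smul, Matrix.mulVec_mulVec,
    dotProduct_comm]

/-- Applying the anticommutator to `v` gives `x · (e₀ · v) = 2 x⁰ v`, hence `2 x⁰ ⟨v, v⟩ = ⟨x · (e₀
· v), v⟩ = ⟨e₀ · v, x · v⟩ = 0`. -/
lemma moduleInner_self_eq_zero_of_gammaLin_mulVec_eq_zero (x : Fin n → ℝ) (hx : x 0 ≠ 0)
    (v : SpinorModule n) (h : gammaLin n x *ᵥ v = 0) : moduleInner n v v = 0 := by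
  have h1 : gammaLin n x *ᵥ (gamma 0 *ᵥ v) = (2 * x 0) • v := by
    have h2 := congrArg (· *ᵥ v) (gammaLin_anticomm_gamma_zero n x)
    simpa only [Matrix.add_mulVec, ← Matrix.mulVec_mulVec, h, Matrix.mulVec_zero, zero_add,
      Matrix.smul_mulVec, Matrix.one_mulVec] using h2
  have h3 : (2 * x 0) • moduleInner n v v = 0 := by
    have h4 := moduleInner_mulVec n _ _ (conj_gammaLin_mul n x) (gamma 0 *ᵥ v) v
    rw [h1, h] at h4
    rw [moduleInner, ← smul_dotProduct, ← Matrix.mulVec_smul]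
    simpa [moduleInner] using h4.symm
  exact (smul_eq_zero.1 h3).resolve_left (mul_ne_zero two_ne_zero hx)

/-- The `gamma 0` in the definition of `moduleInner` cancels the one applied to `v`; this makes the
time component of the Dirac current nonnegative. -/
lemma moduleInner_gamma_zero (v : SpinorModule n) :
    moduleInner n (gamma 0 *ᵥ v) v = v ⬝ᵥ star v := by
  rw [moduleInner, Matrix.mulVec_mulVec, gamma_zero_sq, Matrix.one_mulVec]

end Module

/-! ### The Dirac current at a point, read in a spin frame. -/

section Fiber

variable {n : ℕ} [NeZero n] {M : Type*} [TopologicalSpace M]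
  [ChartedSpace (EuclideanSpace ℝ (Fin n)) M] [IsManifold (𝓡 n) ∞ M]
  {g : LorentzianMetric n M} {o : ManifoldOrientation n M} {t : TimeOrientation g}
  (P : SpinStructure g o t)

lemma inner_eq_sum_components {x : M} (q : P.Q x) (X Y : TangentSpace (𝓡 n) x) :
    g.inner x X Y = ∑ i, minkowskiSign i * components P q X i * components P q Y i := by
  conv_lhs =>
    rw [← (P.frame q).basis.sum_equivFun X, ← (P.frame q).basis.sum_equivFun Y]
  simp only [map_sum, map_smul, sum_apply, smul_apply,
    (P.frame q).orthonormal, smul_eq_mul, mul_ite, mul_zero, Finset.sum_ite_eq',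
    Finset.mem_univ, if_true, components]
  exact Finset.sum_congr rfl fun i _ => by ring

/-- Translates lightlike tangent vectors into zeros of `cliffordForm`, whose Clifford matrices
square to zero. -/
lemma cliffordForm_components {x : M} (q : P.Q x) (X : TangentSpace (𝓡 n) x) :
    cliffordForm n (components P q X) = -g.inner x X X := by
  rw [inner_eq_sum_components P q, ← Finset.sum_neg_distrib, cliffordForm,
    QuadraticMap.weightedSumSquares_apply]
  exact Finset.sum_congr rfl fun i _ => by rw [smul_eq_mul]; ring

lemma components_frame {x : M} (q : P.Q x) (i : Fin n) :
    components P q ((P.frame q).basis i) = Pi.single i 1 := by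
  ext j
  simp [components, Pi.single_apply, eq_comm]

/-- The time component of the Dirac current is the positive definite norm square. -/
lemma components_diracCurrent_zero {x : M} (ψ : SpinorFiber P x) (q : P.Q x) :
    (components P q (diracCurrent P ψ) 0 : ℂ) = ψ.1 q ⬝ᵥ star (ψ.1 q) := by
  -- Pairing with the timelike frame vector gives minus the time component, which matches the minus
  -- sign in the definition of the current.
  have h := inner_diracCurrent P ψ ((P.frame q).basis 0)
  rw [spinorInner_eq P _ _ q, cliffordMul_apply, components_frame,
    inner_eq_sum_components P q, components_frame] at h
  have h1 : gammaLin n (Pi.single 0 1) = gamma 0 := by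
    simp [gammaLin]
  rw [h1, moduleInner_gamma_zero] at h
  simpa [Pi.single_apply, minkowskiSign] using h

lemma cliffordMul_diracCurrent_eq_zero {x : M} (ψ : SpinorFiber P x)
    (h : g.inner x (diracCurrent P ψ) (diracCurrent P ψ) = 0) :
    cliffordMul P (diracCurrent P ψ) ψ = 0 := by
  ext1
  funext q
  have h1 := gammaLin_mulVec_dotProduct_star_self n (components P q (diracCurrent P ψ))
    (by rw [cliffordForm_components, h, neg_zero]) (ψ.1 q)
  -- The current is tested against itself: `g(V, V) = -⟨V · ψ, ψ⟩`, so the lightlike condition also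
  -- kills this pairing.
  have h2 := inner_diracCurrent P ψ (diracCurrent P ψ)
  rw [h, spinorInner_eq P _ _ q, cliffordMul_apply, Complex.ofReal_zero, zero_eq_neg] at h2
  rw [h2, smul_zero] at h1
  -- Definiteness of the standard Hermitian product; the order on `ℂ` is what makes `v ⬝ᵥ star v` a
  -- positive quantity.
  open scoped ComplexOrder in
  exact dotProduct_self_star_eq_zero.1 h1

lemma spinorInner_self_eq_zero_of_cliffordMul_diracCurrent {x : M} (ψ : SpinorFiber P x)
    (h : cliffordMul P (diracCurrent P ψ) ψ = 0) : spinorInner P ψ ψ = 0 := by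
  obtain ⟨q⟩ := nonempty_fiber P x
  rw [spinorInner_eq P _ _ q]
  -- This covers the zeros of the current: a vanishing time component is a vanishing norm, which
  -- forces `ψ = 0`.
  by_cases h0 : components P q (diracCurrent P ψ) 0 = 0
  · have h1 := components_diracCurrent_zero P ψ q
    rw [h0, Complex.ofReal_zero] at h1
    have h2 : ψ.1 q = 0 := by
      open scoped ComplexOrder in
      exact dotProduct_self_star_eq_zero.1 h1.symm
    rw [h2]
    simp [moduleInner]
  · refine moduleInner_self_eq_zero_of_gammaLin_mulVec_eq_zero n _ h0 _ ?_
    rw [← cliffordMul_apply, h]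
    rfl

end Fiber

end LorentzSpin

theorem mainTheorem5 {n : ℕ} [NeZero n] {M : Type*} [TopologicalSpace M]
    [ChartedSpace (EuclideanSpace ℝ (Fin n)) M] [IsManifold (𝓡 n) ∞ M]
    (g : LorentzianMetric n M) (o : ManifoldOrientation n M) (t : TimeOrientation g)
    (P : SpinStructure g o t) (φ : SpinorField P)
    (hV : ∀ x : M,
      g.inner x (diracCurrent P (φ.toFun x)) (diracCurrent P (φ.toFun x)) = 0) :
    (∀ x : M, cliffordMul P (diracCurrent P (φ.toFun x)) (φ.toFun x) = 0) ∧
      ∀ x : M, spinorInner P (φ.toFun x) (φ.toFun x) = 0 := by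
  have h := fun x => cliffordMul_diracCurrent_eq_zero P (φ.toFun x) (hV x)
  exact ⟨h, fun x => spinorInner_self_eq_zero_of_cliffordMul_diracCurrent P _ (h x)⟩
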